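/- Let $d\geqslant 2$ and let $C_d$ be the degree-$d$ Chebyshev polynomial, $C_0(z)=1$, $C_1(z)=z$, $C_d(z)=2zC_{d-1}(z)-C_{d-2}(z)$ (so $C_d(\cos\theta)=\cos(d\theta)$). Its post-critical set in $\mathbb{C}$, i.e. the set of all points $C_d^{n}(c)$ with $n\geqslant 1$ and $C_d'(c)=0$, is $\{-1,1\}$, and $C_d$ induces a degree-$d$ covering $C_d:\mathbb{C}\setminus C_d^{-1}(\{-1,1\})\to\mathcal{M}=\mathbb{C}\setminus\{-1,1\}$, where $\mathbb{C}\setminus C_d^{-1}(\{-1,1\})\subseteq\mathcal{M}$. For every $n\geqslant 0$ the iterate $C_d^{n}:\mathbb{C}\setminus C_d^{-n}(\{-1,1\})\to\mathcal{M}$ is a covering as well. Take the base point $t=0$ and let $a(s)=-1+e^{2\pi i s}$ and $b(s)=1-e^{2\pi i s}$, $s\in[0,1]$, be the loops based at $t$ that surround $-1$, respectively $1$, once counterclockwise; write $\gamma.\delta$ for the concatenation of loops ($\gamma$ first). Let $\Phi:\pi_1(\mathcal{M},t)\to\mathrm{Sym}\bigl(\bigsqcup_{n\geqslant 0}C_d^{-n}(t)\bigr)$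 be the monodromy action: for $x\in C_d^{-n}(t)$, $[\gamma]x$ is the end point of the lift of $\gamma$ from $x$ under the covering $C_d^{n}$. Let $\mathrm{IMG}(C_d,t)=\pi_1(\mathcal{M},t)/\mathrm{Ker}(\Phi)$ be the iterated monodromy group. Then: 1. $[a]$ and $[b]$ generate $\pi_1(\mathcal{M},t)$, and $\mathrm{Ker}(\Phi)$ is the normal subgroup of $\pi_1(\mathcal{M},t)$ generated by $[a^2]=[a.a]$ and $[b^2]=[b.b]$. 2. Hence $\mathrm{IMG}(C_d,t)$ is the infinite dihedral group: there is an isomorphism from the group $\langle a,b\mid a^2,b^2\rangle$ onto $\mathrm{IMG}(C_d,t)$ that sends the generators $a,b$ to the classes of $[a],[b]$. There is also an isomorphism from $\mathrm{IMG}(C_d,t)$ onto the isometry group of $\mathbb{Z}$ that sends the classes of $[a],[b]$ to $k\mapsto -k$ and $k\mapsto 1-k$. 3. For every $n\geqslant 0$ the level $C_d^{-n}(t)$ has exactly $d^n$ elements, and $[a.b]$ and $[b.a]$ each act on it as a cyclic permutation of order $d^n$ (a single cycle through all the elements). -/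

import Mathlib

open scoped unitInterval

noncomputable section

/-! ### Partial self-coverings, tree of preimages and monodromy action -/

section General

variable {X : Type*} [TopologicalSpace X]

/-- The map `f` with `f(P) ⊆ P` induces a degree `d` partial self-covering
`f : X \ f⁻¹(P) → X \ P` of the path connected, locally path connected space `X \ P`. -/
structure InducesPartialSelfCovering (f : X → X) (P : Set X) (d : ℕ) : Prop where
  mapsTo : Set.MapsTo f P P
  pathConnected : PathConnectedSpace ↥Pᶜ
  locPathConnected : LocallyPathConnectedSpace ↥Pᶜ
  two_le : 2 ≤ d
  isCovering : IsCoveringMap (Pᶜ.restrictPreimage f)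
  degree : ∀ y : ↥Pᶜ, Nat.card (Pᶜ.restrictPreimage f ⁻¹' {y}) = d

/-- The `n`-th iterate `pⁿ : Mₙ → M` of the partial self-covering induced by `f`, where
`M = X \ P` and `Mₙ = p⁻ⁿ(M) = X \ f⁻ⁿ(P)`. -/
def iterCover (f : X → X) (P : Set X) (n : ℕ) : ↥(f^[n] ⁻¹' Pᶜ) → ↥Pᶜ :=
  Pᶜ.restrictPreimage f^[n]

/-- The vertices of level `n` of the tree of preimages: the set `p⁻ⁿ(t)`. -/
abbrev PreimageLevel (f : X → X) (P : Set X) (t : ↥Pᶜ) (n : ℕ) : Type _ :=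
  ↥(iterCover f P n ⁻¹' {t})

/-- All the vertices of the tree of preimages: the disjoint union of the `p⁻ⁿ(t)`, `n ≥ 0`. -/
abbrev PreimageTree (f : X → X) (P : Set X) (t : ↥Pᶜ) : Type _ :=
  Σ n : ℕ, PreimageLevel f P t n

/-- The monodromy action on level `n`: `[γ]x` is the end point of the `pⁿ`-lift of `γ` from `x`. -/
def levelMonodromy (f : X → X) (P : Set X) (h : ∀ n, IsCoveringMap (iterCover f P n))
    (t : ↥Pᶜ) (n : ℕ) : FundamentalGroup ↥Pᶜ t →* Equiv.Perm (PreimageLevel f P t n) :=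
  (h n).monodromyPerm t

/-- The monodromy action `Φ` of the fundamental group on the vertices of the tree of preimages. -/
def monodromyAction (f : X → X) (P : Set X) (h : ∀ n, IsCoveringMap (iterCover f P n))
    (t : ↥Pᶜ) : FundamentalGroup ↥Pᶜ t →* Equiv.Perm (PreimageTree f P t) :=
  (Equiv.Perm.sigmaCongrRightHom (PreimageLevel f P t)).comp
    (MonoidHom.pi (levelMonodromy f P h t))

/-- The iterated monodromy group `π₁(M, t) / Ker Φ`. -/
abbrev IteratedMonodromyGroup (f : X → X) (P : Set X) (h : ∀ n, IsCoveringMap (iterCover f P n))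
    (t : ↥Pᶜ) : Type _ :=
  FundamentalGroup ↥Pᶜ t ⧸ (monodromyAction f P h t).ker

/-- The homotopy class of a loop. In Mathlib's fundamental group,
`loopClass (γ.trans δ) = loopClass δ * loopClass γ`. -/
def loopClass {t : X} (γ : Path t t) : FundamentalGroup X t :=
  FundamentalGroup.fromPath (Path.Homotopic.Quotient.mk γ)

end General

/-! ### Chebyshev polynomials -/

/-- The post-critical set in `ℂ` of a polynomial: the points `pⁿ(c)` where `n ≥ 1` and `c` is a
critical point. -/
def postCriticalSet (p : Polynomial ℂ) : Set ℂ :=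
  {w | ∃ c : ℂ, p.derivative.eval c = 0 ∧ ∃ n : ℕ, 1 ≤ n ∧ (fun z => p.eval z)^[n] c = w}

/-- The degree `d` Chebyshev polynomial as a map `ℂ → ℂ`. -/
def chebyshevMap (d : ℕ) (z : ℂ) : ℂ := (Polynomial.Chebyshev.T ℂ d).eval z

/-- The set `{-1, 1}`. -/
abbrev chebyshevP : Set ℂ := {-1, 1}

theorem chebyshevMap_iterate (d n : ℕ) : (chebyshevMap d)^[n] = chebyshevMap (d ^ n) := by
  induction n with
  | zero => funext z; simp [chebyshevMap]
  | succ n ih =>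
    funext z
    rw [Function.iterate_succ_apply, ih]
    simp [chebyshevMap, pow_succ, Polynomial.Chebyshev.T_mul]

theorem chebyshev_critical_value (d : ℕ) (c : ℂ)
    (hc : (Polynomial.Chebyshev.T ℂ d).derivative.eval c = 0) :
    chebyshevMap d c ∈ chebyshevP := by
  rcases Nat.eq_zero_or_pos d with rfl | hd
  · simp [chebyshevMap]
  obtain ⟨θ, rfl⟩ := Complex.cos_surjective c
  have hd' : (d : ℂ) ≠ 0 := by exact_mod_cast hd.ne'
  have hU : (Polynomial.Chebyshev.U ℂ (d - 1)).eval (Complex.cos θ) = 0 := by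
    simpa [Polynomial.Chebyshev.T_derivative_eq_U, hd'] using hc
  have hs := Polynomial.Chebyshev.U_complex_cos θ (d - 1)
  rw [hU, zero_mul] at hs
  have hs' : Complex.sin (d * θ) = 0 := by
    rw [hs]; push_cast; ring_nf
  have h1 := Complex.sin_sq_add_cos_sq (d * θ)
  have h2 : chebyshevMap d (Complex.cos θ) = Complex.cos (d * θ) := by
    simpa [chebyshevMap] using Polynomial.Chebyshev.T_complex_cos θ d
  rw [h2]
  rw [hs'] at h1
  have h3 : Complex.cos (d * θ) = 1 ∨ Complex.cos (d * θ) = -1 := by simpa using h1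
  rcases h3 with h | h <;> simp [h]

theorem isCoveringMap_iterCover_chebyshev (d n : ℕ) :
    IsCoveringMap (iterCover (chebyshevMap d) chebyshevP n) := by
  unfold iterCover
  rw [chebyshevMap_iterate]
  refine IsCoveringMapOn.isCoveringMap_restrictPreimage _
    ((Polynomial.Chebyshev.T ℂ (d ^ n : ℕ)).isCoveringMapOn_eval.mono ?_)
  rintro w hw ⟨c, hc, rfl⟩
  exact hw (chebyshev_critical_value _ c hc)

/-- The base point `0` of `ℂ \ {-1, 1}`. -/
def basePt : ↥chebyshevPᶜ := ⟨0, by simp⟩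

theorem exp_ne_two (s : ℝ) : Complex.exp (2 * Real.pi * s * Complex.I) ≠ 2 := by
  intro h
  have h1 := Complex.norm_exp_ofReal_mul_I (2 * Real.pi * s)
  push_cast at h1
  rw [h] at h1
  norm_num at h1

/-- The loop `s ↦ -1 + exp (2πis)`, based at `0`, that surrounds `-1` once counterclockwise. -/
def loopA : Path basePt basePt where
  toFun s := ⟨-1 + Complex.exp (2 * Real.pi * (s : ℝ) * Complex.I), by
    rintro (h | h)
    · exact Complex.exp_ne_zero _ (by linear_combination h)
    · exact exp_ne_two s (by linear_combination Set.mem_singleton_iff.mp h)⟩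
  continuous_toFun := by fun_prop
  source' := by simp [basePt]
  target' := by simp [basePt]

/-- The loop `s ↦ 1 - exp (2πis)`, based at `0`, that surrounds `1` once counterclockwise. -/
def loopB : Path basePt basePt where
  toFun s := ⟨1 - Complex.exp (2 * Real.pi * (s : ℝ) * Complex.I), by
    rintro (h | h)
    · exact exp_ne_two s (by linear_combination -h)
    · exact Complex.exp_ne_zero (2 * Real.pi * (s : ℝ) * Complex.I)
        (by linear_combination -Set.mem_singleton_iff.mp h)⟩
  continuous_toFun := by fun_prop
  source' := by simp [basePt]
  target' := by simp [basePt]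

/-- The monodromy action of `C_d : ℂ \ C_d⁻¹({-1, 1}) → ℂ \ {-1, 1}` with base point `0`. -/
def chebyshevMonodromy (d : ℕ) :
    FundamentalGroup ↥chebyshevPᶜ basePt →*
      Equiv.Perm (PreimageTree (chebyshevMap d) chebyshevP basePt) :=
  monodromyAction (chebyshevMap d) chebyshevP (isCoveringMap_iterCover_chebyshev d) basePt

/-- The monodromy action of `C_d` on level `n`. -/
def chebyshevLevel (d n : ℕ) :
    FundamentalGroup ↥chebyshevPᶜ basePt →*
      Equiv.Perm (PreimageLevel (chebyshevMap d) chebyshevP basePt n) :=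
  levelMonodromy (chebyshevMap d) chebyshevP (isCoveringMap_iterCover_chebyshev d) basePt n

/-- The iterated monodromy group of `C_d` with base point `0`. -/
abbrev ChebyshevIMG (d : ℕ) : Type :=
  IteratedMonodromyGroup (chebyshevMap d) chebyshevP (isCoveringMap_iterCover_chebyshev d) basePt

/-- The quotient map `π₁(ℂ \ {-1, 1}, 0) → IMG(C_d)`. -/
def toChebyshevIMG (d : ℕ) : FundamentalGroup ↥chebyshevPᶜ basePt →* ChebyshevIMG d :=
  QuotientGroup.mk' _

/-- The relators `a²`, `b²` of the infinite dihedral group, with `a = of 0`, `b = of 1`. -/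
def dihedralRels : Set (FreeGroup (Fin 2)) :=
  {FreeGroup.of 0 ^ 2, FreeGroup.of 1 ^ 2}

end

/-! Everything rests on `cos`, which conjugates $C_m$ to multiplication by $m$: $C_m(\cos
z)=\cos(mz)$ and $C_d^n=C_{d^n}$. The fibre of $C_d^n$ over $0=\cos(\pi/2)$ therefore consists of
the points $\cos((\pi/2+2\pi j)/d^n)$, labelled by $j$ modulo $d^n$. Lifting $a$ and $b$ through
`cos` from $\pi/2$ ends at $3\pi/2$ and $-\pi/2$; dividing shifted lifts by $d^n$ gives lifts under
$C_d^n$. Since `cos` is even, $a$ acts by $j\mapsto -1-j$ and $b$ by $j\mapsto -j$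
(`chebyshevLevel_loopA`, `chebyshevLevel_loopB`). Both are involutions, and $a.b$, $b.a$ are the
shifts by $\pm1$, hence $d^n$-cycles.

No nonzero integer is divisible by every $d^n$, so the product of the two involutions has infinite
order on the tree. In a group generated by two involutions, a homomorphism that keeps their product
of infinite order is injective (`injective_of_involutions`). Applied modulo the squares this gives
the kernel; applied to $\langle a,b\mid a^2,b^2\rangle$ it gives both isomorphisms.

Generation of $\pi_1$ is the surjectivity half of van Kampen for the cover by $\mathrm{Re}<1$ and
$\mathrm{Re}>-1$. Each piece is a punctured half plane, whose fundamental group is cyclic because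
`exp` covers it by a contractible set. -/

noncomputable section

/-! ### Groups generated by two involutions -/

section Dihedral

variable {G H : Type*} [Group G] [Group H]

theorem semiconjBy_mul_of_involutions {x y : G} (hx : x * x = 1) (hy : y * y = 1) :
    SemiconjBy x (x * y) (x * y)⁻¹ := by
  have hx' : x⁻¹ = x := inv_eq_of_mul_eq_one_left hx
  have hy' : y⁻¹ = y := inv_eq_of_mul_eq_one_left hy
  rw [SemiconjBy, mul_inv_rev, hx', hy', ← mul_assoc, hx, one_mul, mul_assoc, hx, mul_one]

/-- The rotations and reflections listed here are stable under left multiplication by both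
generators, because `x` inverts `x * y` and `y = x * (x * y)`. -/
theorem eq_zpow_or_eq_zpow_mul_of_involutions {x y : G} (hx : x * x = 1) (hy : y * y = 1)
    (hgen : Subgroup.closure {x, y} = ⊤) (g : G) :
    ∃ k : ℤ, g = (x * y) ^ k ∨ g = (x * y) ^ k * x := by
  have hx' : x⁻¹ = x := inv_eq_of_mul_eq_one_left hx
  have hy' : y⁻¹ = y := inv_eq_of_mul_eq_one_left hy
  have hxmul : ∀ g : G, (∃ k : ℤ, g = (x * y) ^ k ∨ g = (x * y) ^ k * x) →
      ∃ k : ℤ, x * g = (x * y) ^ k ∨ x * g = (x * y) ^ k * x := by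
    rintro g ⟨k, hk⟩
    have hs : x * (x * y) ^ k = (x * y) ^ (-k) * x := by
      have := ((semiconjBy_mul_of_involutions hx hy).zpow_right k).eq
      rwa [inv_zpow'] at this
    refine ⟨-k, ?_⟩
    rcases hk with rfl | rfl
    · exact Or.inr hs
    · left
      rw [← mul_assoc, hs, mul_assoc, hx, mul_one]
  have hymul : ∀ g : G, (∃ k : ℤ, g = (x * y) ^ k ∨ g = (x * y) ^ k * x) →
      ∃ k : ℤ, y * g = (x * y) ^ k ∨ y * g = (x * y) ^ k * x := by
    rintro g ⟨k, hk⟩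
    have hyg : y * g = x * ((x * y) * g) := by
      rw [← mul_assoc, ← mul_assoc, hx, one_mul]
    rw [hyg]
    refine hxmul _ ⟨k + 1, ?_⟩
    rcases hk with rfl | rfl
    · exact Or.inl (by rw [add_comm k, zpow_one_add])
    · exact Or.inr (by rw [add_comm k, zpow_one_add, mul_assoc (x * y)])
  have hg : g ∈ Subgroup.closure {x, y} := hgen ▸ Subgroup.mem_top g
  induction hg using Subgroup.closure_induction_left with
  | one => exact ⟨0, Or.inl (zpow_zero _).symm⟩
  | mul_left z hz w _ ih =>
    rcases hz with rfl | rfl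
    · exact hxmul w ih
    · exact hymul w ih
  | inv_mul_cancel z hz w _ ih =>
    rcases hz with rfl | rfl
    · rw [hx']; exact hxmul w ih
    · rw [hy']; exact hymul w ih

/-- A homomorphism from a group generated by two involutions is injective if it maps their product
to an element of infinite order. -/
theorem injective_of_involutions {x y : G} (hx : x * x = 1) (hy : y * y = 1)
    (hgen : Subgroup.closure {x, y} = ⊤) (f : G →* H)
    (hf : ∀ k : ℤ, f (x * y) ^ k = 1 → k = 0) : Function.Injective f := by
  rw [injective_iff_map_eq_one]
  intro g hg
  obtain ⟨k, rfl | rfl⟩ := eq_zpow_or_eq_zpow_mul_of_involutions hx hy hgen g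
  · rw [hf k (by rw [← map_zpow, hg]), zpow_zero]
  -- A reflection conjugates `x * y` to its inverse; if `f` killed it, `f (x * y)` would be its own
  -- inverse and have order dividing 2.
  · exfalso
    have hs : SemiconjBy ((x * y) ^ k * x) (x * y) (x * y)⁻¹ :=
      SemiconjBy.mul_left ((Commute.refl (x * y)).inv_right.zpow_left k)
        (semiconjBy_mul_of_involutions hx hy)
    have h := congrArg f hs.eq
    rw [map_mul f _ (x * y), map_mul f (x * y)⁻¹, hg, one_mul, mul_one, map_inv] at h
    have h2 : f (x * y) ^ (2 : ℤ) = 1 := by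
      rw [zpow_two]
      nth_rewrite 1 [h]
      exact inv_mul_cancel _
    exact absurd (hf 2 h2) two_ne_zero

/-- Modulo the normal closure the generators become involutions, so the map induced by `f` is
injective. -/
theorem ker_eq_normalClosure_of_involutions {x y : G} (hgen : Subgroup.closure {x, y} = ⊤)
    (f : G →* H) (hx : f (x * x) = 1) (hy : f (y * y) = 1)
    (hf : ∀ k : ℤ, f (x * y) ^ k = 1 → k = 0) :
    f.ker = Subgroup.normalClosure {x * x, y * y} := by
  have hle : Subgroup.normalClosure {x * x, y * y} ≤ f.ker := by
    refine Subgroup.normalClosure_le_normal ?_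
    rintro _ (rfl | rfl)
    · exact hx
    · exact hy
  refine le_antisymm (fun g hg => ?_) hle
  let π := QuotientGroup.mk' (Subgroup.normalClosure {x * x, y * y})
  have h1 : π x * π x = 1 := by
    rw [← map_mul]
    exact (QuotientGroup.eq_one_iff _).mpr (Subgroup.subset_normalClosure (by simp))
  have h2 : π y * π y = 1 := by
    rw [← map_mul]
    exact (QuotientGroup.eq_one_iff _).mpr (Subgroup.subset_normalClosure (by simp))
  have h3 : Subgroup.closure {π x, π y} = ⊤ := by
    rw [← Set.image_pair, ← MonoidHom.map_closure, hgen, ← MonoidHom.range_eq_map,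
      MonoidHom.range_eq_top]
    exact QuotientGroup.mk'_surjective _
  have hinj := injective_of_involutions h1 h2 h3
    (QuotientGroup.lift (Subgroup.normalClosure {x * x, y * y}) f hle) hf
  refine (QuotientGroup.eq_one_iff g).mp (hinj ?_)
  rw [map_one]
  exact hg

theorem exists_presentedGroup_dihedralRels_equiv {x y : H} (hx : x * x = 1) (hy : y * y = 1)
    (hgen : Subgroup.closure {x, y} = ⊤) (hxy : ∀ k : ℤ, (x * y) ^ k = 1 → k = 0) :
    ∃ e : PresentedGroup dihedralRels ≃* H,
      e (PresentedGroup.of 0) = x ∧ e (PresentedGroup.of 1) = y := by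
  have hrels : ∀ r ∈ dihedralRels, FreeGroup.lift ![x, y] r = 1 := by
    rintro r (rfl | rfl) <;> simp [pow_two, hx, hy]
  let f : PresentedGroup dihedralRels →* H := PresentedGroup.toGroup hrels
  have h0 : f (PresentedGroup.of 0) = x := by simp [f]
  have h1 : f (PresentedGroup.of 1) = y := by simp [f]
  have hsq : ∀ i : Fin 2, (PresentedGroup.of i : PresentedGroup dihedralRels) *
      PresentedGroup.of i = 1 := by
    intro i
    refine PresentedGroup.one_of_mem (x := FreeGroup.of i * FreeGroup.of i) ?_
    fin_cases i <;> simp [dihedralRels, pow_two]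
  have hcl : Subgroup.closure {(PresentedGroup.of 0 : PresentedGroup dihedralRels),
      PresentedGroup.of 1} = ⊤ := by
    rw [← PresentedGroup.closure_range_of]
    congr 1
    ext z
    simp [Fin.exists_fin_two, eq_comm]
  have hinj : Function.Injective f := by
    refine injective_of_involutions (hsq 0) (hsq 1) hcl f fun k hk => hxy k ?_
    rwa [map_mul, h0, h1] at hk
  have hsurj : Function.Surjective f := by
    rw [← MonoidHom.range_eq_top, MonoidHom.range_eq_map, ← hcl, MonoidHom.map_closure,
      Set.image_pair, h0, h1, hgen]
  exact ⟨MulEquiv.ofBijective f ⟨hinj, hsurj⟩, h0, h1⟩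

end Dihedral

/-! ### The isometry group of `ℤ` -/

section IntIsometry

/-- The reflection `k ↦ c - k` of `ℤ`. -/
def intReflection (c : ℤ) : ℤ ≃ᵢ ℤ := IsometryEquiv.subLeft c

@[simp] theorem intReflection_apply (c k : ℤ) : intReflection c k = c - k := rfl

theorem intReflection_mul_self (c : ℤ) : intReflection c * intReflection c = 1 := by
  ext k
  simp [IsometryEquiv.mul_apply]

theorem intReflection_mul_zpow_apply (k j : ℤ) :
    ((intReflection 1 * intReflection 0) ^ k) j = j + k := by
  induction k generalizing j with
  | zero => simp
  | succ n ih => rw [zpow_add_one, IsometryEquiv.mul_apply, ih]; simp [IsometryEquiv.mul_apply]; ring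
  | pred n ih =>
    rw [zpow_sub_one, IsometryEquiv.mul_apply, ih, mul_inv_rev,
      inv_eq_of_mul_eq_one_left (intReflection_mul_self 0),
      inv_eq_of_mul_eq_one_left (intReflection_mul_self 1)]
    simp [IsometryEquiv.mul_apply]; ring

/-- The value at `1` is `f 0 ± 1`, and the distances to `f 0` and `f 1` then determine every `f k`.
-/
theorem isometry_int_eq (f : ℤ ≃ᵢ ℤ) : (∀ k, f k = f 0 + k) ∨ (∀ k, f k = f 0 - k) := by
  have hd : ∀ j k : ℤ, |f j - f k| = |j - k| := by
    intro j k
    have := f.isometry.dist_eq j k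
    rw [Int.dist_eq', Int.dist_eq'] at this
    exact_mod_cast this
  rcases abs_eq_abs.mp (hd 1 0) with h | h
  · left
    intro k
    have h2 := hd k 0
    have h3 := hd k 1
    rcases abs_eq_abs.mp h2 with h2 | h2 <;> rcases abs_eq_abs.mp h3 with h3 | h3 <;> omega
  · right
    intro k
    have h2 := hd k 0
    have h3 := hd k 1
    rcases abs_eq_abs.mp h2 with h2 | h2 <;> rcases abs_eq_abs.mp h3 with h3 | h3 <;> omega

theorem closure_intReflection : Subgroup.closure {intReflection 0, intReflection 1} = ⊤ := by
  rw [Subgroup.eq_top_iff']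
  intro f
  have h0 : intReflection 0 ∈ Subgroup.closure {intReflection 0, intReflection 1} :=
    Subgroup.subset_closure (by simp)
  have h1 : intReflection 1 ∈ Subgroup.closure {intReflection 0, intReflection 1} :=
    Subgroup.subset_closure (by simp)
  have ht := Subgroup.zpow_mem _ (Subgroup.mul_mem _ h1 h0) (f 0)
  rcases isometry_int_eq f with h | h
  · convert ht using 1
    ext k
    rw [intReflection_mul_zpow_apply, h, add_comm]
  · convert Subgroup.mul_mem _ ht h0 using 1
    ext k
    rw [IsometryEquiv.mul_apply, intReflection_mul_zpow_apply, h, intReflection_apply]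
    ring

theorem intReflection_mul_zpow_eq_one {k : ℤ}
    (hk : (intReflection 0 * intReflection 1) ^ k = 1) : k = 0 := by
  have h : intReflection 0 * intReflection 1 = (intReflection 1 * intReflection 0)⁻¹ := by
    rw [mul_inv_rev, inv_eq_of_mul_eq_one_left (intReflection_mul_self 0),
      inv_eq_of_mul_eq_one_left (intReflection_mul_self 1)]
  rw [h, inv_zpow, inv_eq_one] at hk
  have := intReflection_mul_zpow_apply k 0
  rw [hk] at this
  simpa using this.symm

end IntIsometry

/-! ### Generation of the fundamental group from an open cover -/

section VanKampen

variable {X : Type*} [TopologicalSpace X]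

open CategoryTheory

/-- The loop `c x · γ · (c y)⁻¹`, where `c x` is a chosen path from the base point to `x`. -/
def conjLoop {t : X} (c : ∀ x, Path t x) {x y : X} (γ : Path x y) : Path t t :=
  ((c x).trans γ).trans (c y).symm

theorem loopClass_conjLoop_trans {t : X} (c : ∀ x, Path t x) {x y z : X} (γ : Path x y)
    (δ : Path y z) :
    loopClass (conjLoop c (γ.trans δ)) =
      loopClass (conjLoop c δ) * loopClass (conjLoop c γ) := by
  let C (x : X) : FundamentalGroupoid.mk t ⟶ FundamentalGroupoid.mk x :=
    FundamentalGroupoid.fromPath (Path.Homotopic.Quotient.mk (c x))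
  let g : FundamentalGroupoid.mk x ⟶ FundamentalGroupoid.mk y :=
    FundamentalGroupoid.fromPath (Path.Homotopic.Quotient.mk γ)
  let h : FundamentalGroupoid.mk y ⟶ FundamentalGroupoid.mk z :=
    FundamentalGroupoid.fromPath (Path.Homotopic.Quotient.mk δ)
  change (C x ≫ g ≫ h) ≫ Groupoid.inv (C z) =
    ((C x ≫ g) ≫ Groupoid.inv (C y)) ≫ (C y ≫ h) ≫ Groupoid.inv (C z)
  simp

theorem loopClass_conjLoop_loop {t : X} (c : ∀ x, Path t x) (γ : Path t t) :
    loopClass (conjLoop c γ) = (loopClass (c t))⁻¹ * (loopClass γ * loopClass (c t)) :=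
  rfl

theorem loopClass_congr {t : X} {γ δ : Path t t} (h : γ.Homotopic δ) :
    loopClass γ = loopClass δ :=
  Path.Homotopic.Quotient.eq.mpr h

theorem range_conjLoop_subset {t : X} {c : ∀ x, Path t x} {x y : X} {γ : Path x y} {U : Set X}
    (hx : Set.range (c x) ⊆ U) (hγ : Set.range γ ⊆ U) (hy : Set.range (c y) ⊆ U) :
    Set.range (conjLoop c γ) ⊆ U := by
  rw [conjLoop, Path.trans_range, Path.trans_range, Path.symm_range]
  exact Set.union_subset (Set.union_subset hx hγ) hy

/-- If `X` is the union of two open sets such that any point is joined to the base point within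
each of the sets it belongs to, then the loops contained in one of the two sets generate the
fundamental group. -/
theorem subgroup_eq_top_of_open_cover {U V : Set X} (hU : IsOpen U) (hV : IsOpen V)
    (hUV : ∀ x, x ∈ U ∨ x ∈ V) {t : X} (c : ∀ x, Path t x)
    (hcU : ∀ x ∈ U, Set.range (c x) ⊆ U) (hcV : ∀ x ∈ V, Set.range (c x) ⊆ V)
    (S : Subgroup (FundamentalGroup X t))
    (hS : ∀ γ : Path t t, Set.range γ ⊆ U ∨ Set.range γ ⊆ V → loopClass γ ∈ S) : S = ⊤ := by
  have hsmall : ∀ {x y : X} (γ : Path x y), Set.range γ ⊆ U ∨ Set.range γ ⊆ V →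
      loopClass (conjLoop c γ) ∈ S := by
    intro x y γ hγ
    have hx : x ∈ Set.range γ := ⟨0, γ.source⟩
    have hy : y ∈ Set.range γ := ⟨1, γ.target⟩
    refine hS _ (hγ.imp (fun h => ?_) fun h => ?_)
    · exact range_conjLoop_subset (hcU x (h hx)) h (hcU y (h hy))
    · exact range_conjLoop_subset (hcV x (h hx)) h (hcV y (h hy))
  have hall : ∀ γ : Path t t, loopClass (conjLoop c γ) ∈ S := by
    intro γ
    let W : Bool → Set X := fun i => cond i U V
    -- Lebesgue subdivision: each piece of `γ` stays in `U` or in `V`, and conjugating it by the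
    -- chosen paths gives a loop in the same set.
    obtain ⟨τ, hτ0, hτm, ⟨N, hN⟩, hτ⟩ := exists_monotone_Icc_subset_open_cover_unitInterval
      (c := fun i => γ ⁻¹' W i)
      (fun i => by
        cases i
        · exact hV.preimage γ.continuous
        · exact hU.preimage γ.continuous)
      (fun s _ => by
        rcases hUV (γ s) with h | h
        · exact Set.mem_iUnion.mpr ⟨true, h⟩
        · exact Set.mem_iUnion.mpr ⟨false, h⟩)
    have hind : ∀ n, loopClass (conjLoop c (γ.subpath (τ 0) (τ n))) ∈ S := by
      intro n
      induction n with
      | zero =>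
        refine hsmall _ ?_
        rw [Path.subpath_self]
        simpa only [Path.refl_range, Set.singleton_subset_iff] using hUV (γ (τ 0))
      | succ n ih =>
        have hstep : loopClass (conjLoop c (γ.subpath (τ n) (τ (n + 1)))) ∈ S := by
          refine hsmall _ ?_
          obtain ⟨i, hi⟩ := hτ n
          rw [Path.range_subpath_of_le _ _ _ (hτm n.le_succ), Set.image_subset_iff,
            Set.image_subset_iff]
          cases i
          · exact Or.inr hi
          · exact Or.inl hi
        have h := S.mul_mem hstep ih
        rw [← loopClass_conjLoop_trans] at h
        have hhom : (conjLoop c ((γ.subpath (τ 0) (τ n)).trans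
            (γ.subpath (τ n) (τ (n + 1))))).Homotopic
            (conjLoop c (γ.subpath (τ 0) (τ (n + 1)))) :=
          ((Path.Homotopic.refl _).hcomp
            ⟨Path.Homotopy.subpathTransSubpath γ _ _ _⟩).hcomp (Path.Homotopic.refl _)
        rwa [loopClass_congr hhom] at h
    have h := hind N
    rw [hτ0, hN N le_rfl, Path.subpath_zero_one] at h
    have hcast : ∀ {x y : X} (hx : x = t) (hy : y = t),
        loopClass (conjLoop c (γ.cast hx hy)) ∈ S → loopClass (conjLoop c γ) ∈ S := by
      rintro x y rfl rfl h
      exact h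
    exact hcast _ _ h
  -- The path `c t` need not be constant, but it is itself a loop in one of the sets, so the
  -- conjugation by it can be undone inside `S`.
  have hc : loopClass (c t) ∈ S := by
    refine hS _ ((hUV t).imp (fun h => hcU t h) fun h => hcV t h)
  rw [Subgroup.eq_top_iff']
  intro g
  obtain ⟨γ, rfl⟩ := Path.Homotopic.Quotient.mk_surjective g
  have h := hall γ
  rw [loopClass_conjLoop_loop] at h
  have h1 := S.mul_mem (S.mul_mem hc h) (S.inv_mem hc)
  have h2 : loopClass (c t) * ((loopClass (c t))⁻¹ * (loopClass γ * loopClass (c t))) *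
      (loopClass (c t))⁻¹ = loopClass γ := by group
  rwa [h2] at h1

end VanKampen

/-! ### The punctured half plane and its exponential cover -/

section PuncturedHalfPlane

/-- The half plane `Re w < 2` without the point `0`. -/
abbrev puncturedHalfPlane : Set ℂ := {w | w ≠ 0 ∧ w.re < 2}

/-- The preimage of the half plane `Re w < 2` under the exponential function. -/
abbrev logHalfPlane : Set ℂ := {z | (Complex.exp z).re < 2}

/-- The exponential function as a map onto the punctured half plane. -/
def expHalfPlane : C(logHalfPlane, puncturedHalfPlane) where
  toFun z := ⟨Complex.exp z, Complex.exp_ne_zero _, z.2⟩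
  continuous_toFun := by fun_prop

/-- The point `1` of the punctured half plane. -/
def halfPlaneOne : puncturedHalfPlane := ⟨1, one_ne_zero, by norm_num⟩

/-- For `0 ≤ u ≤ 1` one has $e^{ux}\le\max(1,e^x)$, so sliding horizontally to the imaginary axis
keeps $e^x\cos y<2$. -/
theorem exp_re_lt_two_of_contract {z : ℂ} (hz : (Complex.exp z).re < 2) {u : ℝ} (h0 : 0 ≤ u)
    (h1 : u ≤ 1) : (Complex.exp ((u * z.re : ℝ) + z.im * Complex.I)).re < 2 := by
  have key : ∀ x y : ℝ, (Complex.exp ((x : ℂ) + y * Complex.I)).re = Real.exp x * Real.cos y := by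
    intro x y
    simp [Complex.exp_re]
  rw [Complex.exp_re] at hz
  rw [key]
  rcases le_or_gt (Real.cos z.im) 0 with hc | hc
  · nlinarith [Real.exp_pos (u * z.re)]
  · rcases le_or_gt z.re 0 with hx | hx
    · have : Real.exp (u * z.re) ≤ 1 := Real.exp_le_one_iff.mpr (by nlinarith)
      nlinarith [Real.cos_le_one z.im, Real.exp_pos (u * z.re)]
    · have : Real.exp (u * z.re) ≤ Real.exp z.re := Real.exp_le_exp.mpr (by nlinarith)
      nlinarith

theorem exp_mul_I_re_lt_two (y : ℝ) : (Complex.exp (y * Complex.I)).re < 2 := by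
  rw [Complex.exp_ofReal_mul_I_re]
  linarith [Real.cos_le_one y]

/-- Contract horizontally onto the imaginary axis, then along the axis to `0`. -/
instance : ContractibleSpace logHalfPlane := by
  rw [contractible_iff_id_nullhomotopic]
  have hzero : (0 : ℂ) ∈ logHalfPlane := by simp
  let f : C(logHalfPlane, logHalfPlane) :=
    ⟨fun z => ⟨(z : ℂ).im * Complex.I, exp_mul_I_re_lt_two _⟩, by fun_prop⟩
  refine ⟨⟨0, hzero⟩, ContinuousMap.Homotopic.trans (g := f) ⟨?_⟩ ⟨?_⟩⟩
  · exact {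
      toFun := fun p => ⟨(((1 - (p.1 : ℝ)) * (p.2 : ℂ).re : ℝ) : ℂ) + (p.2 : ℂ).im * Complex.I,
        exp_re_lt_two_of_contract p.2.2 (by linarith [p.1.2.2]) (by linarith [p.1.2.1])⟩
      continuous_toFun := by fun_prop
      map_zero_left := fun z => Subtype.ext (by simp [Complex.re_add_im])
      map_one_left := fun z => Subtype.ext (by simp [f]) }
  · exact {
      toFun := fun p => ⟨(((1 - (p.1 : ℝ)) * (p.2 : ℂ).im : ℝ) : ℂ) * Complex.I,
        exp_mul_I_re_lt_two _⟩
      continuous_toFun := by fun_prop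
      map_zero_left := fun z => Subtype.ext (by simp [f])
      map_one_left := fun z => Subtype.ext (by simp) }

/-- The points `2πik` over `1`. -/
def logOne (k : ℤ) : logHalfPlane :=
  ⟨((2 * Real.pi * k : ℝ) : ℂ) * Complex.I, exp_mul_I_re_lt_two _⟩

theorem expHalfPlane_logOne (k : ℤ) : expHalfPlane (logOne k) = halfPlaneOne := by
  refine Subtype.ext ?_
  refine Eq.trans ?_ (Complex.exp_int_mul_two_pi_mul_I k)
  simp only [expHalfPlane, logOne, ContinuousMap.coe_mk]
  congr 1
  push_cast
  ring

/-- The image under the exponential function of a path between points over `1`. -/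
def expLoop {j k : ℤ} (γ : Path (logOne j) (logOne k)) : Path halfPlaneOne halfPlaneOne :=
  (γ.map expHalfPlane.continuous).cast (expHalfPlane_logOne j).symm (expHalfPlane_logOne k).symm

theorem loopClass_expLoop_congr {j k : ℤ} (γ δ : Path (logOne j) (logOne k)) :
    loopClass (expLoop γ) = loopClass (expLoop δ) :=
  loopClass_congr (((SimplyConnectedSpace.paths_homotopic γ δ).map expHalfPlane).pathCast _ _)

theorem expLoop_trans {i j k : ℤ} (γ : Path (logOne i) (logOne j)) (δ : Path (logOne j) (logOne k)) :
    expLoop (γ.trans δ) = (expLoop γ).trans (expLoop δ) := by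
  ext s
  simp only [expLoop, Path.cast_coe, Path.map_trans, Path.trans_apply, Path.map_coe,
    Function.comp_apply]

/-- The unit circle as a loop in the punctured half plane. -/
def halfPlaneCircle : Path halfPlaneOne halfPlaneOne where
  toFun s := ⟨Complex.exp (2 * Real.pi * (s : ℝ) * Complex.I), Complex.exp_ne_zero _, by
    exact_mod_cast exp_mul_I_re_lt_two (2 * Real.pi * s)⟩
  continuous_toFun := by fun_prop
  source' := by simp [halfPlaneOne]
  target' := by simp [halfPlaneOne]

/-- The vertical segment from `2πik` to `2πi(k+1)`. -/
def logSegment (k : ℤ) : Path (logOne k) (logOne (k + 1)) where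
  toFun s := ⟨((2 * Real.pi * (k + s) : ℝ) : ℂ) * Complex.I, exp_mul_I_re_lt_two _⟩
  continuous_toFun := by fun_prop
  source' := by simp [logOne]
  target' := by simp [logOne]

theorem expLoop_logSegment (k : ℤ) : expLoop (logSegment k) = halfPlaneCircle := by
  ext s
  change Complex.exp (((2 * Real.pi * (k + s) : ℝ) : ℂ) * Complex.I) =
    Complex.exp (2 * Real.pi * (s : ℝ) * Complex.I)
  rw [Complex.exp_eq_exp_iff_exists_int]
  exact ⟨k, by push_cast; ring⟩

/-- Upstairs only end points matter, so a path may be traded for a chain of unit segments, each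
mapping to the circle. -/
theorem loopClass_expLoop_eq_zpow {k : ℤ} (γ : Path (logOne 0) (logOne k)) :
    loopClass (expLoop γ) = loopClass halfPlaneCircle ^ k := by
  have hstep : ∀ (k : ℤ) (δ : Path (logOne 0) (logOne k)) (ε : Path (logOne 0) (logOne (k + 1))),
      loopClass (expLoop ε) = loopClass halfPlaneCircle * loopClass (expLoop δ) := by
    intro k δ ε
    rw [loopClass_expLoop_congr ε (δ.trans (logSegment k)), expLoop_trans, expLoop_logSegment]
    rfl
  induction k with
  | zero =>
    rw [loopClass_expLoop_congr γ (Path.refl _), zpow_zero]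
    exact Path.Homotopic.Quotient.eq.mpr (by
      convert Path.Homotopic.refl (Path.refl halfPlaneOne)
      ext s
      exact congrArg Subtype.val (expHalfPlane_logOne 0))
  | succ n ih =>
    rw [hstep n (PathConnectedSpace.somePath _ _) γ, ih, zpow_add_one, ← zpow_one_add,
      add_comm, zpow_add_one]
  | pred n ih =>
    have ih' : ∀ m : ℤ, m = -n → ∀ δ : Path (logOne 0) (logOne m),
        loopClass (expLoop δ) = loopClass halfPlaneCircle ^ m := by
      rintro _ rfl
      exact ih
    -- For negative exponents the step is read backwards: the path one segment higher has known
    -- class, and the circle is cancelled.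
    have h := hstep (-n - 1) γ (PathConnectedSpace.somePath _ _)
    rw [ih' _ (sub_add_cancel _ _), zpow_add_one, ((Commute.refl _).zpow_left _).eq] at h
    exact (mul_left_cancel h).symm

/-- The fundamental group of the punctured half plane is generated by the unit circle. -/
theorem exists_loopClass_eq_zpow_halfPlaneCircle (γ : Path halfPlaneOne halfPlaneOne) :
    ∃ k : ℤ, loopClass γ = loopClass halfPlaneCircle ^ k := by
  -- The lift of `γ` to `ℂ` automatically stays in `logHalfPlane`, since that set is a full
  -- preimage.
  obtain ⟨F, hF, hF0⟩ := Complex.isCoveringMap_exp.exists_path_lifts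
    ⟨fun s => (⟨(γ s : ℂ), (γ s).2.1⟩ : {z : ℂ // z ≠ 0}), by fun_prop⟩ 0
    (Subtype.ext ((congrArg Subtype.val γ.source).trans Complex.exp_zero.symm))
  have hexp : ∀ s, Complex.exp (F s) = γ s := fun s => congrArg Subtype.val (congrFun hF s)
  have h1 : Complex.exp (F 1) = 1 := by rw [hexp, γ.target]; rfl
  obtain ⟨k, hk⟩ := Complex.exp_eq_one_iff.mp h1
  let Γ : Path (logOne 0) (logOne k) :=
    { toFun := fun s => ⟨F s, by rw [Set.mem_ofPred_eq, hexp]; exact (γ s).2.2⟩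
      continuous_toFun := by fun_prop
      source' := Subtype.ext (by simp [hF0, logOne])
      target' := Subtype.ext (by simp only [hk, logOne]; push_cast; ring) }
  have hΓ : expLoop Γ = γ := by
    ext s
    exact hexp s
  exact ⟨k, by rw [← hΓ, loopClass_expLoop_eq_zpow]⟩

end PuncturedHalfPlane

/-! ### Generators of the fundamental group of `ℂ \ {-1, 1}` -/

section TwicePuncturedPlane

theorem loopClass_map_cast_mem_zpowers {X : Type*} [TopologicalSpace X]
    (f : C(puncturedHalfPlane, X)) {t : X} (hf : f halfPlaneOne = t)
    (δ : Path halfPlaneOne halfPlaneOne) :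
    loopClass ((δ.map f.continuous).cast hf.symm hf.symm) ∈
      Subgroup.zpowers (loopClass ((halfPlaneCircle.map f.continuous).cast hf.symm hf.symm)) := by
  subst hf
  obtain ⟨k, hk⟩ := exists_loopClass_eq_zpow_halfPlaneCircle δ
  refine ⟨k, ?_⟩
  change FundamentalGroup.map f halfPlaneOne (loopClass halfPlaneCircle) ^ k =
    FundamentalGroup.map f halfPlaneOne (loopClass δ)
  rw [hk, map_zpow]

theorem loopClass_mem_zpowers_loopA (γ : Path basePt basePt) (hγ : ∀ s, (γ s : ℂ).re < 1) :
    loopClass γ ∈ Subgroup.zpowers (loopClass loopA) := by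
  let f : C(puncturedHalfPlane, ↥chebyshevPᶜ) :=
    { toFun := fun w => ⟨-1 + w, by
        rintro (h | h)
        · exact w.2.1 (by linear_combination h)
        · have h2 : (w : ℂ) = 2 := by linear_combination Set.mem_singleton_iff.mp h
          have := w.2.2
          rw [h2] at this
          norm_num at this⟩
      continuous_toFun := by fun_prop }
  have hf : f halfPlaneOne = basePt := Subtype.ext (by simp [f, halfPlaneOne, basePt])
  let δ : Path halfPlaneOne halfPlaneOne :=
    { toFun := fun s => ⟨1 + γ s, fun h => (γ s).2 (Or.inl (by linear_combination h)), by
        rw [Complex.add_re, Complex.one_re]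
        linarith [hγ s]⟩
      continuous_toFun := by fun_prop
      source' := Subtype.ext (show 1 + (γ 0 : ℂ) = 1 by rw [γ.source]; simp [basePt])
      target' := Subtype.ext (show 1 + (γ 1 : ℂ) = 1 by rw [γ.target]; simp [basePt]) }
  convert loopClass_map_cast_mem_zpowers f hf δ using 1
  · congr 1
  · congr 1
    ext s
    simp [f, δ]

theorem loopClass_mem_zpowers_loopB (γ : Path basePt basePt) (hγ : ∀ s, -1 < (γ s : ℂ).re) :
    loopClass γ ∈ Subgroup.zpowers (loopClass loopB) := by
  let f : C(puncturedHalfPlane, ↥chebyshevPᶜ) :=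
    { toFun := fun w => ⟨1 - w, by
        rintro (h | h)
        · have h2 : (w : ℂ) = 2 := by linear_combination -h
          have := w.2.2
          rw [h2] at this
          norm_num at this
        · exact w.2.1 (by linear_combination -Set.mem_singleton_iff.mp h)⟩
      continuous_toFun := by fun_prop }
  have hf : f halfPlaneOne = basePt := Subtype.ext (by simp [f, halfPlaneOne, basePt])
  let δ : Path halfPlaneOne halfPlaneOne :=
    { toFun := fun s => ⟨1 - γ s, fun h => (γ s).2 (Or.inr (by
          rw [Set.mem_singleton_iff]
          linear_combination -h)), by
        rw [Complex.sub_re, Complex.one_re]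
        linarith [hγ s]⟩
      continuous_toFun := by fun_prop
      source' := Subtype.ext (show 1 - (γ 0 : ℂ) = 1 by rw [γ.source]; simp [basePt])
      target' := Subtype.ext (show 1 - (γ 1 : ℂ) = 1 by rw [γ.target]; simp [basePt]) }
  convert loopClass_map_cast_mem_zpowers f hf δ using 1
  · congr 1
  · congr 1
    ext s
    simp [f, δ]

theorem lineMap_re (x y : ℂ) (s : ℝ) :
    (AffineMap.lineMap x y s).re = (1 - s) * x.re + s * y.re := by
  simp [AffineMap.lineMap_apply_module]

theorem lineMap_im (x y : ℂ) (s : ℝ) :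
    (AffineMap.lineMap x y s).im = (1 - s) * x.im + s * y.im := by
  simp [AffineMap.lineMap_apply_module]

/-- The segment between two points of `ℂ \ {-1, 1}` in the same closed half plane bounded by the
real axis, the first of which is not real. -/
def halfPlaneSegment (r : ℝ) (x y : ↥chebyshevPᶜ) (hx : 0 < r * (x : ℂ).im)
    (hy : 0 ≤ r * (y : ℂ).im) : Path x y where
  toFun s := ⟨AffineMap.lineMap (x : ℂ) (y : ℂ) (s : ℝ), by
    intro h
    have him : (AffineMap.lineMap (x : ℂ) (y : ℂ) (s : ℝ)).im = 0 := by
      rcases h with h | h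
      · rw [h]; simp
      · rw [Set.mem_singleton_iff.mp h]; simp
    -- As `x` is off the real axis, the segment can be real only at its end point `y`.
    have hs : (s : ℝ) = 1 := by
      rw [lineMap_im] at him
      by_contra hne
      have hlt : 0 < 1 - (s : ℝ) := sub_pos.mpr (lt_of_le_of_ne s.2.2 hne)
      have him' : (1 - (s : ℝ)) * (r * (x : ℂ).im) + s * (r * (y : ℂ).im) = 0 := by
        linear_combination r * him
      linarith [mul_pos hlt hx, mul_nonneg s.2.1 hy]
    rw [hs, AffineMap.lineMap_apply_one] at h
    exact y.2 h⟩
  continuous_toFun := by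
    refine Continuous.subtype_mk ?_ _
    simp only [AffineMap.lineMap_apply_module]
    fun_prop
  source' := by simp
  target' := by simp

/-- The points `±i` as points of `ℂ \ {-1, 1}`. -/
def signedI (r : ℝ) (hr : r ≠ 0) : ↥chebyshevPᶜ :=
  ⟨r * Complex.I, by
    rintro (h | h)
    · exact hr (by simpa using congrArg Complex.im h)
    · exact hr (by simpa using congrArg Complex.im (Set.mem_singleton_iff.mp h))⟩

/-- A path from `0` to `x` via `ri`. -/
def pathVia (r : ℝ) (hr : r ≠ 0) (x : ↥chebyshevPᶜ) (hx : 0 ≤ r * (x : ℂ).im) : Path basePt x :=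
  have h : 0 < r * (signedI r hr : ℂ).im := by simpa [signedI] using mul_self_pos.mpr hr
  (halfPlaneSegment r (signedI r hr) basePt h (by simp [basePt])).symm.trans
    (halfPlaneSegment r (signedI r hr) x h hx)

theorem pathVia_range_subset {r : ℝ} {hr : r ≠ 0} {x : ↥chebyshevPᶜ} {hx : 0 ≤ r * (x : ℂ).im}
    {C : Set ℝ} (hC : Convex ℝ C) (h0 : (0 : ℝ) ∈ C) (hxC : (x : ℂ).re ∈ C) :
    Set.range (pathVia r hr x hx) ⊆ {z | (z : ℂ).re ∈ C} := by
  have hseg : ∀ (x y : ↥chebyshevPᶜ) (hx : 0 < r * (x : ℂ).im) (hy : 0 ≤ r * (y : ℂ).im),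
      (x : ℂ).re ∈ C → (y : ℂ).re ∈ C →
      Set.range (halfPlaneSegment r x y hx hy) ⊆ {z | (z : ℂ).re ∈ C} := by
    rintro x y hx hy hxC hyC _ ⟨s, rfl⟩
    change (AffineMap.lineMap (x : ℂ) (y : ℂ) (s : ℝ)).re ∈ C
    rw [lineMap_re]
    exact hC hxC hyC (by linarith [s.2.2]) s.2.1 (by ring)
  have hI : (signedI r hr : ℂ).re ∈ C := by simpa [signedI] using h0
  rw [pathVia, Path.trans_range, Path.symm_range]
  exact Set.union_subset (hseg _ _ _ _ hI (by simpa [basePt] using h0)) (hseg _ _ _ _ hI hxC)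

/-- The path goes through `i` or `-i`, on the side of `x`. One path must work for all convex `C` at
once, since a point in both half planes needs a single path lying in both. -/
theorem exists_path_range_subset (x : ↥chebyshevPᶜ) : ∃ γ : Path basePt x,
    ∀ C : Set ℝ, Convex ℝ C → (0 : ℝ) ∈ C → (x : ℂ).re ∈ C →
      Set.range γ ⊆ {z | (z : ℂ).re ∈ C} := by
  rcases le_total 0 (x : ℂ).im with h | h
  · exact ⟨pathVia 1 one_ne_zero x (by simpa using h), fun C hC => pathVia_range_subset hC⟩
  · exact ⟨pathVia (-1) (by norm_num) x (by simpa using h), fun C hC => pathVia_range_subset hC⟩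

theorem closure_loopClass_eq_top :
    Subgroup.closure {loopClass loopA, loopClass loopB} = ⊤ := by
  choose c hc using exists_path_range_subset
  refine subgroup_eq_top_of_open_cover (U := {z : ↥chebyshevPᶜ | (z : ℂ).re ∈ Set.Iio 1})
    (V := {z : ↥chebyshevPᶜ | (z : ℂ).re ∈ Set.Ioi (-1)})
    (isOpen_Iio.preimage (by fun_prop)) (isOpen_Ioi.preimage (by fun_prop)) ?_ c ?_ ?_ _ ?_
  · intro x
    rcases lt_or_ge (x : ℂ).re 1 with h | h
    · exact Or.inl h
    · exact Or.inr (show (-1 : ℝ) < (x : ℂ).re by linarith)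
  · exact fun x hx => hc x _ (convex_Iio 1) (by simp) hx
  · exact fun x hx => hc x _ (convex_Ioi (-1)) (by simp) hx
  · rintro γ (h | h)
    · exact (Subgroup.zpowers_le.mpr (Subgroup.subset_closure (by simp)))
        (loopClass_mem_zpowers_loopA γ fun s => h ⟨s, rfl⟩)
    · exact (Subgroup.zpowers_le.mpr (Subgroup.subset_closure (by simp)))
        (loopClass_mem_zpowers_loopB γ fun s => h ⟨s, rfl⟩)

end TwicePuncturedPlane

/-! ### Explicit lifts of the two loops through the cosine -/

section Arcsine

/-- A branch of the inverse sine on the unit disk. -/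
def diskArcsin (w : ℂ) : ℂ :=
  -Complex.I * Complex.log (Complex.I * w + Complex.exp (Complex.log (1 - w ^ 2) / 2))

theorem exp_half_log_sq {z : ℂ} (hz : z ≠ 0) : Complex.exp (Complex.log z / 2) ^ 2 = z := by
  rw [← Complex.exp_nat_mul]
  push_cast
  rw [mul_div_cancel₀ _ two_ne_zero, Complex.exp_log hz]

theorem one_sub_sq_re_pos {w : ℂ} (hw : ‖w‖ < 1) : 0 < (1 - w ^ 2).re := by
  have h : (w ^ 2).re ≤ ‖w ^ 2‖ := Complex.re_le_norm _
  rw [norm_pow] at h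
  have h2 : ‖w‖ ^ 2 < 1 := by nlinarith [norm_nonneg w]
  rw [Complex.sub_re, Complex.one_re]
  linarith

theorem exp_half_log_re_pos {z : ℂ} (hz : 0 < z.re) : 0 < (Complex.exp (Complex.log z / 2)).re := by
  rw [Complex.exp_re]
  have him : (Complex.log z / 2).im = z.arg / 2 := by
    rw [Complex.div_ofNat_im, Complex.log_im]
  rw [him]
  refine mul_pos (Real.exp_pos _) (Real.cos_pos_of_mem_Ioo ?_)
  have harg := abs_lt.mp (Complex.abs_arg_lt_pi_div_two_iff.mpr (Or.inl hz))
  constructor <;> linarith [Real.pi_pos]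

/-- With $u=\sqrt{1-w^2}$, comparing real parts of $u^2=1-w^2$ gives
$(\mathrm{Re}\,u)^2>(\mathrm{Im}\,w)^2$. This keeps the outer logarithm off its branch cut. -/
theorem diskArcsin_aux_re_pos {w : ℂ} (hw : ‖w‖ < 1) :
    0 < (Complex.I * w + Complex.exp (Complex.log (1 - w ^ 2) / 2)).re := by
  have h0 := one_sub_sq_re_pos hw
  have hne : (1 - w ^ 2) ≠ 0 := fun h => by simp [h] at h0
  have hsq := exp_half_log_sq hne
  set u := Complex.exp (Complex.log (1 - w ^ 2) / 2) with hu
  have hpos : 0 < u.re := exp_half_log_re_pos h0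
  have hre := congrArg Complex.re hsq
  simp only [pow_two, Complex.mul_re, Complex.sub_re, Complex.one_re] at hre
  have hn : w.re * w.re + w.im * w.im < 1 := by
    have : Complex.normSq w < 1 := by
      rw [Complex.normSq_eq_norm_sq]; nlinarith [norm_nonneg w]
    rwa [Complex.normSq_apply] at this
  rw [Complex.add_re, Complex.I_mul_re]
  by_contra hle
  nlinarith [mul_self_nonneg u.im, mul_self_nonneg w.im, mul_self_nonneg w.re]

theorem sin_diskArcsin {w : ℂ} (hw : ‖w‖ < 1) : Complex.sin (diskArcsin w) = w := by
  have hpos := diskArcsin_aux_re_pos hw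
  have h0 := one_sub_sq_re_pos hw
  have hne : (1 - w ^ 2) ≠ 0 := fun h => by simp [h] at h0
  have hsq := exp_half_log_sq hne
  rw [Complex.sin, diskArcsin]
  set u := Complex.exp (Complex.log (1 - w ^ 2) / 2) with hu
  have ha : Complex.I * w + u ≠ 0 := fun h => by simp [h] at hpos
  have h1 : -Complex.I * Complex.log (Complex.I * w + u) * Complex.I =
      Complex.log (Complex.I * w + u) := by
    linear_combination (-Complex.log (Complex.I * w + u)) * Complex.I_sq
  have h2 : -(-Complex.I * Complex.log (Complex.I * w + u)) * Complex.I =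
      -Complex.log (Complex.I * w + u) := by
    linear_combination (Complex.log (Complex.I * w + u)) * Complex.I_sq
  -- This is $(u+iw)(u-iw)=u^2+w^2=1$.
  have hinv : (Complex.I * w + u)⁻¹ = -Complex.I * w + u := by
    refine inv_eq_of_mul_eq_one_right ?_
    linear_combination hsq - w ^ 2 * Complex.I_sq
  rw [h1, h2, Complex.exp_neg, Complex.exp_log ha, hinv]
  linear_combination -w * Complex.I_sq

theorem continuousOn_diskArcsin : ContinuousOn diskArcsin (Metric.ball 0 1) := by
  refine ContinuousOn.mul continuousOn_const (ContinuousOn.clog ?_ fun w hw =>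
    Or.inl (diskArcsin_aux_re_pos (mem_ball_zero_iff.mp hw)))
  refine ContinuousOn.add (by fun_prop) (ContinuousOn.cexp (ContinuousOn.div_const
    (ContinuousOn.clog (by fun_prop) fun w hw => Or.inl ?_) _))
  exact one_sub_sq_re_pos (mem_ball_zero_iff.mp hw)

theorem diskArcsin_sin {y : ℝ} (h1 : -(Real.pi / 2) < y) (h2 : y < Real.pi / 2) :
    diskArcsin (Real.sin y) = y := by
  have hc : 0 < Real.cos y := Real.cos_pos_of_mem_Ioo ⟨h1, h2⟩
  have hsq : (1 : ℂ) - (Real.sin y : ℂ) ^ 2 = ((Real.cos y ^ 2 : ℝ) : ℂ) := by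
    rw [Real.cos_sq']
    push_cast
    ring
  have hlog : Complex.exp (Complex.log ((1 : ℂ) - (Real.sin y : ℂ) ^ 2) / 2) = Real.cos y := by
    rw [hsq, ← Complex.ofReal_log (sq_nonneg _), Real.log_pow]
    have : (((2 : ℕ) : ℝ) * Real.log (Real.cos y) : ℝ) / (2 : ℂ) =
        ((Real.log (Real.cos y) : ℝ) : ℂ) := by push_cast; ring
    rw [this, ← Complex.ofReal_exp, Real.exp_log hc]
  have harg : Complex.I * (Real.sin y : ℂ) + Real.cos y = Complex.exp (y * Complex.I) := by
    rw [Complex.exp_mul_I, Complex.ofReal_cos, Complex.ofReal_sin]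
    ring
  rw [diskArcsin, hlog, harg, Complex.log_exp]
  · linear_combination (-(y : ℂ)) * Complex.I_sq
  · simpa using by linarith [Real.pi_pos]
  · simpa using by linarith [Real.pi_pos]

/-- Half the lift of $b$: by the double angle formula $\cos 2\beta=1-e^{2\pi is}$, while
$\cos(\pi-2\beta)$ traces $a$. -/
theorem exists_arcsin_path : ∃ β : C(I, ℂ),
    (∀ s : I, 2 * Complex.sin (β s) ^ 2 = Complex.exp (2 * Real.pi * (s : ℝ) * Complex.I)) ∧
      β 0 = Real.pi / 4 ∧ β 1 = -(Real.pi / 4) := by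
  have hs : ((Real.sin (Real.pi / 4) : ℝ) : ℂ) ^ 2 = 1 / 2 := by
    rw [← Complex.ofReal_pow, Real.sin_pi_div_four, div_pow, Real.sq_sqrt (by norm_num)]
    norm_num
  -- A continuous root $\sin\beta=e^{\pi is}/\sqrt2$; its modulus is below 1, so one branch on the
  -- disk suffices, and the half turn flips its sign.
  let w : I → ℂ := fun s =>
    Complex.exp ((Real.pi * (s : ℝ) : ℝ) * Complex.I) * (Real.sin (Real.pi / 4) : ℝ)
  have hw : ∀ s, ‖w s‖ < 1 := by
    intro s
    have h1 : ‖w s‖ ^ 2 < 1 := by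
      rw [norm_mul, Complex.norm_exp_ofReal_mul_I, one_mul, ← norm_pow, hs]
      norm_num
    nlinarith [norm_nonneg (w s)]
  refine ⟨⟨fun s => diskArcsin (w s), ?_⟩, fun s => ?_, ?_, ?_⟩
  · exact continuousOn_diskArcsin.comp_continuous (by fun_prop)
      fun s => mem_ball_zero_iff.mpr (hw s)
  · change 2 * Complex.sin (diskArcsin (w s)) ^ 2 = _
    rw [sin_diskArcsin (hw s), mul_pow, hs, ← Complex.exp_nat_mul]
    push_cast
    ring_nf
  · change diskArcsin (w 0) = _
    have h : w 0 = (Real.sin (Real.pi / 4) : ℝ) := by simp [w]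
    rw [h, diskArcsin_sin (by linarith [Real.pi_pos]) (by linarith [Real.pi_pos])]
    push_cast
    rfl
  · change diskArcsin (w 1) = _
    have h : w 1 = (Real.sin (-(Real.pi / 4)) : ℝ) := by
      simp [w, Real.sin_neg]
    rw [h, diskArcsin_sin (by linarith [Real.pi_pos]) (by linarith [Real.pi_pos])]
    push_cast
    rfl

theorem exists_arccos_lift_loopA : ∃ α : C(I, ℂ),
    (∀ s, Complex.cos (α s) = loopA s) ∧ α 0 = Real.pi / 2 ∧ α 1 = 3 * Real.pi / 2 := by
  obtain ⟨β, hβ, h0, h1⟩ := exists_arcsin_path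
  refine ⟨⟨fun s => Real.pi - 2 * β s, by fun_prop⟩, fun s => ?_, ?_, ?_⟩
  · change Complex.cos (Real.pi - 2 * β s) =
      -1 + Complex.exp (2 * Real.pi * (s : ℝ) * Complex.I)
    rw [Complex.cos_pi_sub, Complex.cos_two_mul, ← hβ, Complex.cos_sq']
    ring
  · simp only [ContinuousMap.coe_mk, h0]
    ring
  · simp only [ContinuousMap.coe_mk, h1]
    ring

theorem exists_arccos_lift_loopB : ∃ α : C(I, ℂ),
    (∀ s, Complex.cos (α s) = loopB s) ∧ α 0 = Real.pi / 2 ∧ α 1 = -(Real.pi / 2) := by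
  obtain ⟨β, hβ, h0, h1⟩ := exists_arcsin_path
  refine ⟨⟨fun s => 2 * β s, by fun_prop⟩, fun s => ?_, ?_, ?_⟩
  · change Complex.cos (2 * β s) = 1 - Complex.exp (2 * Real.pi * (s : ℝ) * Complex.I)
    rw [Complex.cos_two_mul, ← hβ, Complex.cos_sq']
    ring
  · simp only [ContinuousMap.coe_mk, h0]
    ring
  · simp only [ContinuousMap.coe_mk, h1]
    ring

end Arcsine

/-! ### Fibres of Chebyshev polynomials -/

section Fibre

theorem chebyshevMap_cos (m : ℕ) (z : ℂ) : chebyshevMap m (Complex.cos z) = Complex.cos (m * z) := by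
  simp [chebyshevMap]

/-- The points of the fibre of the Chebyshev polynomial of degree `m` over `cos θ`. -/
def fibrePoint (m : ℕ) (θ : ℂ) (j : ℤ) : ℂ := Complex.cos ((θ + 2 * Real.pi * j) / m)

theorem cos_mem_chebyshevP_of_sin_eq_zero {θ : ℂ} (h : Complex.sin θ = 0) :
    Complex.cos θ ∈ chebyshevP := by
  have h1 := Complex.sin_sq_add_cos_sq θ
  rw [h] at h1
  have h3 : Complex.cos θ = 1 ∨ Complex.cos θ = -1 := by simpa using h1
  exact h3.symm

theorem chebyshevMap_cos_div {m : ℕ} (hm : 0 < m) (α : ℂ) (j : ℤ) :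
    chebyshevMap m (Complex.cos ((α + 2 * Real.pi * j) / m)) = Complex.cos α := by
  have hm' : (m : ℂ) ≠ 0 := by exact_mod_cast hm.ne'
  rw [chebyshevMap_cos, mul_div_cancel₀ _ hm']
  have := Complex.cos_add_int_mul_two_pi α j
  rwa [mul_comm (j : ℂ)] at this

theorem exists_fibrePoint_eq {m : ℕ} (hm : 0 < m) {θ z : ℂ} (hz : chebyshevMap m z = Complex.cos θ) :
    ∃ j, fibrePoint m θ j = z := by
  have hm' : (m : ℂ) ≠ 0 := by exact_mod_cast hm.ne'
  obtain ⟨w, rfl⟩ := Complex.cos_surjective z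
  rw [chebyshevMap_cos, eq_comm, Complex.cos_eq_cos_iff] at hz
  obtain ⟨k, hk | hk⟩ := hz
  · refine ⟨k, congrArg Complex.cos ?_⟩
    rw [div_eq_iff hm']
    linear_combination -hk
  · refine ⟨-k, ?_⟩
    rw [fibrePoint, ← Complex.cos_neg w]
    congr 1
    rw [div_eq_iff hm']
    push_cast
    linear_combination hk

theorem fibrePoint_eq_iff {m : ℕ} (hm : 0 < m) {θ : ℂ} (hθ : Complex.cos θ ∉ chebyshevP) (j k : ℤ) :
    fibrePoint m θ j = fibrePoint m θ k ↔ (m : ℤ) ∣ j - k := by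
  have hm' : (m : ℂ) ≠ 0 := by exact_mod_cast hm.ne'
  have hpi : (2 * Real.pi : ℂ) ≠ 0 := by
    simp [Real.pi_ne_zero]
  rw [fibrePoint, fibrePoint, Complex.cos_eq_cos_iff]
  constructor
  · rintro ⟨N, hN | hN⟩
    · refine ⟨-N, ?_⟩
      rw [div_eq_iff hm', add_mul, div_mul_cancel₀ _ hm'] at hN
      have h : (2 * Real.pi : ℂ) * (j - k) = 2 * Real.pi * (m * -N) := by linear_combination -hN
      exact_mod_cast mul_left_cancel₀ hpi h
    -- The other sign would force $\theta\in\pi\mathbb{Z}$, that is $\cos\theta=\pm1$.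
    · exfalso
      rw [div_eq_iff hm', sub_mul, div_mul_cancel₀ _ hm'] at hN
      have h : θ = ((N * m - j - k : ℤ) : ℂ) * Real.pi := by
        push_cast
        linear_combination hN / 2
      exact hθ (cos_mem_chebyshevP_of_sin_eq_zero (by rw [h, Complex.sin_int_mul_pi]))
  · rintro ⟨N, hN⟩
    refine ⟨-N, Or.inl ?_⟩
    have hN' : (j : ℂ) - k = m * N := by exact_mod_cast hN
    rw [div_eq_iff hm', add_mul, div_mul_cancel₀ _ hm']
    push_cast
    linear_combination (-2 * Real.pi : ℂ) * hN'

/-- The separate `f` lets the count serve both `chebyshevMap d` and its iterates, which equal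
Chebyshev maps only propositionally. -/
theorem card_fibre_restrictPreimage {m : ℕ} (hm : 0 < m) {f : ℂ → ℂ} (hf : f = chebyshevMap m) (y : ↥chebyshevPᶜ) :
    Nat.card (chebyshevPᶜ.restrictPreimage f ⁻¹' {y}) = m := by
  subst hf
  obtain ⟨y, hy⟩ := y
  obtain ⟨θ, rfl⟩ := Complex.cos_surjective y
  have hval : ∀ j, chebyshevMap m (fibrePoint m θ j) = Complex.cos θ :=
    chebyshevMap_cos_div hm θ
  let g : Fin m → chebyshevPᶜ.restrictPreimage (chebyshevMap m) ⁻¹' {⟨Complex.cos θ, hy⟩} :=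
    fun i => ⟨⟨fibrePoint m θ i, by rw [Set.mem_preimage, hval]; exact hy⟩,
      Subtype.ext (hval i)⟩
  have hg : Function.Bijective g := by
    constructor
    · intro i j hij
      have h : fibrePoint m θ (i : ℕ) = fibrePoint m θ (j : ℕ) :=
        congrArg (fun z => (z.1 : ℂ)) hij
      rw [fibrePoint_eq_iff hm hy] at h
      have h' := (Int.modEq_iff_dvd.mpr h).symm
      rw [Int.natCast_modEq_iff] at h'
      exact Fin.ext (h'.eq_of_lt_of_lt i.2 j.2)
    · rintro ⟨⟨z, hz⟩, hz'⟩
      obtain ⟨j, hj⟩ := exists_fibrePoint_eq hm (congrArg Subtype.val hz')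
      have hm0 : (m : ℤ) ≠ 0 := by exact_mod_cast hm.ne'
      have hnn := Int.emod_nonneg j hm0
      refine ⟨⟨(j % m).toNat, by
        have := Int.emod_lt_of_pos j (by exact_mod_cast hm : (0 : ℤ) < m)
        omega⟩, Subtype.ext (Subtype.ext ?_)⟩
      change fibrePoint m θ ((j % m).toNat : ℤ) = z
      refine Eq.trans ?_ hj
      rw [fibrePoint_eq_iff hm hy, Int.toNat_of_nonneg hnn, Int.emod_def]
      exact ⟨-(j / m), by ring⟩
  rw [← Nat.card_congr (Equiv.ofBijective g hg), Nat.card_eq_fintype_card, Fintype.card_fin]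

end Fibre

/-! ### Monodromy on a level -/

section Monodromy

/-- By uniqueness of lifts, any explicit lift computes the monodromy. -/
theorem levelMonodromy_loopClass_apply {X : Type*} [TopologicalSpace X] {f : X → X} {P : Set X}
    (h : ∀ n, IsCoveringMap (iterCover f P n)) {t : ↥Pᶜ} {n : ℕ} (γ : Path t t) (Γ : C(I, X))
    (hΓ : ∀ s, f^[n] (Γ s) = γ s) (x y : PreimageLevel f P t n) (h0 : Γ 0 = x) (h1 : Γ 1 = y) :
    levelMonodromy f P h t n (loopClass γ) x = y := by
  let Γ' : C(I, ↥(f^[n] ⁻¹' Pᶜ)) :=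
    ⟨fun s => ⟨Γ s, by rw [Set.mem_preimage, hΓ]; exact (γ s).2⟩, by fun_prop⟩
  have hstart : (γ : C(I, ↥Pᶜ)) 0 = iterCover f P n x.1 := γ.source.trans x.2.symm
  have hlift : Γ' = (h n).liftPath γ x.1 hstart :=
    ((h n).eq_liftPath_iff' hstart).mpr
      ⟨funext fun s => Subtype.ext (hΓ s), Subtype.ext h0⟩
  refine Subtype.ext (Subtype.ext (Eq.trans ?_ h1))
  change (((h n).liftPath γ x.1 hstart 1 : ↥(f^[n] ⁻¹' Pᶜ)) : X) = Γ 1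
  rw [← hlift]
  rfl

theorem cos_pi_div_two_notMem : Complex.cos (Real.pi / 2) ∉ chebyshevP := by
  simp [Complex.cos_pi_div_two]

/-- The vertices of level `n` of the tree of preimages of `0`. -/
def levelPoint {d : ℕ} (hd : 0 < d) (n : ℕ) (j : ℤ) :
    PreimageLevel (chebyshevMap d) chebyshevP basePt n :=
  have h : (chebyshevMap d)^[n] (fibrePoint (d ^ n) (Real.pi / 2) j) = 0 := by
    rw [chebyshevMap_iterate, fibrePoint, chebyshevMap_cos_div (pow_pos hd n),
      Complex.cos_pi_div_two]
  ⟨⟨fibrePoint (d ^ n) (Real.pi / 2) j, by rw [Set.mem_preimage, h]; simp⟩, Subtype.ext h⟩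

variable {d : ℕ} (hd : 0 < d) (n : ℕ)

theorem levelPoint_surjective : Function.Surjective (levelPoint hd n) := by
  rintro ⟨⟨z, hz⟩, hz'⟩
  have h : (chebyshevMap d)^[n] z = 0 := congrArg Subtype.val hz'
  rw [chebyshevMap_iterate, ← Complex.cos_pi_div_two] at h
  obtain ⟨j, hj⟩ := exists_fibrePoint_eq (pow_pos hd n) h
  exact ⟨j, Subtype.ext (Subtype.ext hj)⟩

theorem levelPoint_eq_iff (j k : ℤ) :
    levelPoint hd n j = levelPoint hd n k ↔ ((d ^ n : ℕ) : ℤ) ∣ j - k := by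
  rw [← fibrePoint_eq_iff (pow_pos hd n) cos_pi_div_two_notMem]
  exact ⟨fun h => congrArg (fun z => (z.1 : ℂ)) h, fun h => Subtype.ext (Subtype.ext h)⟩

/-- The labelling by `-j` turns the action of `b.a`, a shift by `-1`, into a shift by `+1`. -/
theorem levelPoint_neg_surjective : Function.Surjective fun j => levelPoint hd n (-j) :=
  (levelPoint_surjective hd n).comp neg_surjective

theorem levelPoint_neg_eq_iff (j k : ℤ) :
    levelPoint hd n (-j) = levelPoint hd n (-k) ↔ ((d ^ n : ℕ) : ℤ) ∣ j - k := by
  rw [levelPoint_eq_iff, neg_sub_neg, dvd_sub_comm]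

/-- The sign in `h1` uses that `cos` is even: both loops lift from $\pi/2$ to a point congruent to
$-\pi/2$ modulo $2\pi$. -/
theorem chebyshevLevel_levelPoint (γ : Path basePt basePt) (α : C(I, ℂ))
    (hα : ∀ s, Complex.cos (α s) = γ s) (h0 : α 0 = Real.pi / 2) (j k : ℤ)
    (h1 : α 1 + 2 * Real.pi * j = -(Real.pi / 2 + 2 * Real.pi * k)) :
    chebyshevLevel d n (loopClass γ) (levelPoint hd n j) = levelPoint hd n k := by
  refine levelMonodromy_loopClass_apply _ γ
    ⟨fun s => Complex.cos ((α s + 2 * Real.pi * j) / (d ^ n : ℕ)), by fun_prop⟩ (fun s => ?_) _ _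
    ?_ ?_
  · rw [chebyshevMap_iterate]
    exact (chebyshevMap_cos_div (pow_pos hd n) (α s) j).trans (hα s)
  · simp only [ContinuousMap.coe_mk, h0]
    rfl
  · simp only [ContinuousMap.coe_mk, h1]
    rw [neg_div, Complex.cos_neg]
    rfl

theorem chebyshevLevel_loopA (j : ℤ) :
    chebyshevLevel d n (loopClass loopA) (levelPoint hd n j) = levelPoint hd n (-1 - j) := by
  obtain ⟨α, hα, h0, h1⟩ := exists_arccos_lift_loopA
  refine chebyshevLevel_levelPoint hd n loopA α hα h0 j _ ?_
  rw [h1]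
  push_cast
  ring

theorem chebyshevLevel_loopB (j : ℤ) :
    chebyshevLevel d n (loopClass loopB) (levelPoint hd n j) = levelPoint hd n (-j) := by
  obtain ⟨α, hα, h0, h1⟩ := exists_arccos_lift_loopB
  refine chebyshevLevel_levelPoint hd n loopB α hα h0 j _ ?_
  rw [h1]
  push_cast
  ring

theorem loopClass_trans {X : Type*} [TopologicalSpace X] {t : X} (γ δ : Path t t) :
    loopClass (γ.trans δ) = loopClass δ * loopClass γ :=
  rfl

theorem chebyshevLevel_loopA_trans_loopB (j : ℤ) :
    chebyshevLevel d n (loopClass (loopA.trans loopB)) (levelPoint hd n j) =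
      levelPoint hd n (j + 1) := by
  rw [loopClass_trans, map_mul, Equiv.Perm.mul_apply, chebyshevLevel_loopA, chebyshevLevel_loopB]
  congr 1
  ring

theorem chebyshevLevel_loopB_trans_loopA (j : ℤ) :
    chebyshevLevel d n (loopClass (loopB.trans loopA)) (levelPoint hd n (-j)) =
      levelPoint hd n (-(j + 1)) := by
  rw [loopClass_trans, map_mul, Equiv.Perm.mul_apply, chebyshevLevel_loopB, chebyshevLevel_loopA]
  congr 1
  ring

theorem chebyshevLevel_loopA_sq {d : ℕ} (hd : 0 < d) (n : ℕ) :
    chebyshevLevel d n (loopClass loopA * loopClass loopA) = 1 := by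
  ext1 x
  obtain ⟨j, rfl⟩ := levelPoint_surjective hd n x
  rw [map_mul, Equiv.Perm.mul_apply, chebyshevLevel_loopA, chebyshevLevel_loopA, sub_sub_cancel]
  rfl

theorem chebyshevLevel_loopB_sq {d : ℕ} (hd : 0 < d) (n : ℕ) :
    chebyshevLevel d n (loopClass loopB * loopClass loopB) = 1 := by
  ext1 x
  obtain ⟨j, rfl⟩ := levelPoint_surjective hd n x
  rw [map_mul, Equiv.Perm.mul_apply, chebyshevLevel_loopB, chebyshevLevel_loopB, neg_neg]
  rfl

end Monodromy

/-! ### Permutations that shift an integer labelling -/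

section Cycle

variable {α : Type*} {τ : Equiv.Perm α} {x : ℤ → α} {m : ℕ}

theorem zpow_apply_of_apply_add_one (hτ : ∀ j, τ (x j) = x (j + 1)) (k j : ℤ) :
    (τ ^ k) (x j) = x (j + k) := by
  induction k generalizing j with
  | zero => simp
  | succ n ih => rw [zpow_add_one, Equiv.Perm.mul_apply, hτ, ih]; congr 1; ring
  | pred n ih =>
    rw [zpow_sub_one, Equiv.Perm.mul_apply]
    have h : τ⁻¹ (x j) = x (j - 1) := by
      rw [Equiv.Perm.inv_eq_iff_eq, hτ, sub_add_cancel]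
    rw [h, ih]
    congr 1
    ring

theorem zpow_eq_one_iff_dvd (hτ : ∀ j, τ (x j) = x (j + 1)) (hx : Function.Surjective x)
    (hm : ∀ j k, x j = x k ↔ (m : ℤ) ∣ j - k) (k : ℤ) : τ ^ k = 1 ↔ (m : ℤ) ∣ k := by
  constructor
  · intro h
    have h0 := zpow_apply_of_apply_add_one hτ k 0
    rw [h, Equiv.Perm.one_apply, eq_comm, hm] at h0
    simpa using h0
  · intro h
    ext1 y
    obtain ⟨j, rfl⟩ := hx y
    rw [zpow_apply_of_apply_add_one hτ, Equiv.Perm.one_apply, hm]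
    simpa using h

theorem isCycleOn_univ_of_apply_add_one (hτ : ∀ j, τ (x j) = x (j + 1))
    (hx : Function.Surjective x) : τ.IsCycleOn Set.univ := by
  refine ⟨Set.bijOn_univ.mpr τ.bijective, fun y _ z _ => ?_⟩
  obtain ⟨j, rfl⟩ := hx y
  obtain ⟨k, rfl⟩ := hx z
  exact ⟨k - j, by rw [zpow_apply_of_apply_add_one hτ, add_sub_cancel]⟩

theorem orderOf_eq_of_apply_add_one (hτ : ∀ j, τ (x j) = x (j + 1)) (hx : Function.Surjective x)
    (hm : ∀ j k, x j = x k ↔ (m : ℤ) ∣ j - k) : orderOf τ = m := by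
  refine Nat.dvd_antisymm ?_ ?_
  · exact_mod_cast orderOf_dvd_iff_zpow_eq_one.mpr ((zpow_eq_one_iff_dvd hτ hx hm m).mpr dvd_rfl)
  · exact_mod_cast (zpow_eq_one_iff_dvd hτ hx hm (orderOf τ)).mp (by simp [pow_orderOf_eq_one])

end Cycle

/-! ### The action on the whole tree and the iterated monodromy group -/

section Tree

theorem chebyshevMonodromy_eq_one_iff {d : ℕ} (g : FundamentalGroup ↥chebyshevPᶜ basePt) :
    chebyshevMonodromy d g = 1 ↔ ∀ n, chebyshevLevel d n g = 1 := by
  constructor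
  · intro h n
    ext1 x
    have hx := Equiv.congr_fun h ⟨n, x⟩
    exact eq_of_heq (Sigma.mk.inj_iff.mp hx).2
  · intro h
    ext1 ⟨n, x⟩
    exact congrArg (Sigma.mk n) (Equiv.congr_fun (h n) x)

theorem chebyshevMonodromy_mul_zpow_eq_one {d : ℕ} (hd : 2 ≤ d) {k : ℤ}
    (hk : chebyshevMonodromy d (loopClass loopA * loopClass loopB) ^ k = 1) : k = 0 := by
  have hd0 : 0 < d := by omega
  rw [← map_zpow, chebyshevMonodromy_eq_one_iff] at hk
  have hdvd : ∀ n : ℕ, ((d ^ n : ℕ) : ℤ) ∣ k := by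
    intro n
    have h := hk n
    -- The group product reverses concatenation, so this is the class of `b.a`.
    rw [map_zpow, ← loopClass_trans] at h
    exact (zpow_eq_one_iff_dvd (chebyshevLevel_loopB_trans_loopA hd0 n)
      (levelPoint_neg_surjective hd0 n) (levelPoint_neg_eq_iff hd0 n) k).mp h
  -- Level $|k|$ is deep enough: $d^{|k|}$ divides $k$ and exceeds $|k|$.
  have hlt : k.natAbs < d ^ k.natAbs := Nat.lt_pow_self (by omega)
  have h := Int.natCast_dvd.mp (hdvd k.natAbs)
  exact Int.natAbs_eq_zero.mp (Nat.eq_zero_of_dvd_of_lt h hlt)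

theorem chebyshevMonodromy_loopA_sq {d : ℕ} (hd : 0 < d) :
    chebyshevMonodromy d (loopClass loopA * loopClass loopA) = 1 :=
  (chebyshevMonodromy_eq_one_iff _).mpr (chebyshevLevel_loopA_sq hd)

theorem chebyshevMonodromy_loopB_sq {d : ℕ} (hd : 0 < d) :
    chebyshevMonodromy d (loopClass loopB * loopClass loopB) = 1 :=
  (chebyshevMonodromy_eq_one_iff _).mpr (chebyshevLevel_loopB_sq hd)

theorem toChebyshevIMG_eq_one_iff {d : ℕ} (g : FundamentalGroup ↥chebyshevPᶜ basePt) :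
    toChebyshevIMG d g = 1 ↔ chebyshevMonodromy d g = 1 :=
  (QuotientGroup.eq_one_iff g).trans MonoidHom.mem_ker

theorem exists_presentedGroup_equiv_chebyshevIMG {d : ℕ} (hd : 2 ≤ d) :
    ∃ e : PresentedGroup dihedralRels ≃* ChebyshevIMG d,
      e (PresentedGroup.of 0) = toChebyshevIMG d (loopClass loopA) ∧
      e (PresentedGroup.of 1) = toChebyshevIMG d (loopClass loopB) := by
  have hd0 : 0 < d := by omega
  refine exists_presentedGroup_dihedralRels_equiv ?_ ?_ ?_ fun k hk => ?_
  · rw [← map_mul, toChebyshevIMG_eq_one_iff, chebyshevMonodromy_loopA_sq hd0]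
  · rw [← map_mul, toChebyshevIMG_eq_one_iff, chebyshevMonodromy_loopB_sq hd0]
  · rw [← Set.image_pair, ← MonoidHom.map_closure, closure_loopClass_eq_top,
      ← MonoidHom.range_eq_map, MonoidHom.range_eq_top]
    exact QuotientGroup.mk'_surjective _
  · rw [← map_mul, ← map_zpow, toChebyshevIMG_eq_one_iff, map_zpow] at hk
    exact chebyshevMonodromy_mul_zpow_eq_one hd hk

theorem exists_chebyshevIMG_equiv_int_isometry {d : ℕ} (hd : 2 ≤ d) :
    ∃ e : ChebyshevIMG d ≃* (ℤ ≃ᵢ ℤ),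
      (∀ k : ℤ, e (toChebyshevIMG d (loopClass loopA)) k = -k) ∧
      (∀ k : ℤ, e (toChebyshevIMG d (loopClass loopB)) k = 1 - k) := by
  obtain ⟨e, he0, he1⟩ := exists_presentedGroup_equiv_chebyshevIMG hd
  obtain ⟨e', he0', he1'⟩ := exists_presentedGroup_dihedralRels_equiv (intReflection_mul_self 0)
    (intReflection_mul_self 1) closure_intReflection fun k => intReflection_mul_zpow_eq_one
  refine ⟨e.symm.trans e', fun k => ?_, fun k => ?_⟩
  · rw [← he0, MulEquiv.trans_apply, MulEquiv.symm_apply_apply, he0', intReflection_apply, zero_sub]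
  · rw [← he1, MulEquiv.trans_apply, MulEquiv.symm_apply_apply, he1', intReflection_apply]

end Tree

/-! ### The post-critical set and the partial self-covering -/

section PostCritical

theorem chebyshevMap_mapsTo (d : ℕ) : Set.MapsTo (chebyshevMap d) chebyshevP chebyshevP := by
  intro z hz
  obtain ⟨θ, rfl⟩ := Complex.cos_surjective z
  have hs : Complex.sin θ = 0 := by
    have h1 := Complex.sin_sq_add_cos_sq θ
    rcases hz with h | h
    · rw [h] at h1
      simpa using h1
    · rw [Set.mem_singleton_iff.mp h] at h1
      simpa using h1
  obtain ⟨k, rfl⟩ := Complex.sin_eq_zero_iff.mp hs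
  rw [chebyshevMap_cos]
  refine cos_mem_chebyshevP_of_sin_eq_zero ?_
  rw [← mul_assoc]
  exact_mod_cast Complex.sin_int_mul_pi (d * k)

theorem chebyshev_derivative_eval_eq_zero {d k : ℕ} (hk : 0 < k) (hkd : k < d) :
    (Polynomial.Chebyshev.T ℂ d).derivative.eval (Complex.cos (k * Real.pi / d)) = 0 := by
  have hd : (d : ℂ) ≠ 0 := by exact_mod_cast (by omega : d ≠ 0)
  have hdR : (0 : ℝ) < d := by exact_mod_cast (by omega : 0 < d)
  have hsin : Complex.sin (k * Real.pi / d) ≠ 0 := by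
    have h : 0 < Real.sin (k * Real.pi / d) := by
      refine Real.sin_pos_of_pos_of_lt_pi (by positivity) ?_
      rw [div_lt_iff₀ hdR, mul_comm]
      have : (k : ℝ) < d := by exact_mod_cast hkd
      exact mul_lt_mul_of_pos_left this Real.pi_pos
    have h' : ((Real.sin (k * Real.pi / d) : ℝ) : ℂ) ≠ 0 := by exact_mod_cast h.ne'
    simpa using h'
  have hU := Polynomial.Chebyshev.U_complex_cos (k * Real.pi / d) ((d : ℤ) - 1)
  have hz : Complex.sin ((((d : ℤ) - 1 : ℤ) + 1) * (k * Real.pi / d)) = 0 := by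
    have : (((d : ℤ) - 1 : ℤ) + 1 : ℂ) * (k * Real.pi / d) = k * Real.pi := by
      push_cast
      field_simp
      ring
    rw [this]
    exact Complex.sin_nat_mul_pi k
  rw [hz] at hU
  have hU0 := (mul_eq_zero.mp hU).resolve_right hsin
  rw [Polynomial.Chebyshev.T_derivative_eq_U]
  simp [hU0]

theorem chebyshevMap_cos_nat_mul_pi_div {d : ℕ} (hd : 0 < d) (k : ℕ) :
    chebyshevMap d (Complex.cos (k * Real.pi / d)) = Complex.cos (k * Real.pi) := by
  rw [chebyshevMap_cos, mul_div_cancel₀ _ (by exact_mod_cast hd.ne')]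

theorem postCriticalSet_chebyshev {d : ℕ} (hd : 2 ≤ d) :
    postCriticalSet (Polynomial.Chebyshev.T ℂ d) = {-1, 1} := by
  have hd0 : 0 < d := by omega
  have hneg : chebyshevMap d (Complex.cos ((1 : ℕ) * Real.pi / d)) = -1 := by
    rw [chebyshevMap_cos_nat_mul_pi_div hd0]
    simp
  refine Set.Subset.antisymm ?_ ?_
  · rintro w ⟨c, hc, n, hn, rfl⟩
    obtain ⟨n, rfl⟩ := Nat.exists_eq_add_of_le' hn
    rw [Function.iterate_succ_apply]
    exact (chebyshevMap_mapsTo d).iterate n (chebyshev_critical_value d c hc)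
  · rintro w (rfl | hw)
    · exact ⟨_, chebyshev_derivative_eval_eq_zero one_pos (by omega), 1, le_rfl, hneg⟩
    · rw [Set.mem_singleton_iff.mp hw]
      -- For `d = 2` the only critical value is `-1`, and `1` appears one iterate later; for `d > 2`
      -- the critical point $\cos(2\pi/d)$ maps to `1`.
      rcases hd.eq_or_lt with rfl | hd'
      · refine ⟨_, chebyshev_derivative_eval_eq_zero one_pos (by omega), 2, by norm_num, ?_⟩
        change chebyshevMap 2 (chebyshevMap 2 _) = 1
        rw [hneg, ← Complex.cos_pi, chebyshevMap_cos]
        simp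
      · refine ⟨_, chebyshev_derivative_eval_eq_zero two_pos hd', 1, le_rfl, ?_⟩
        refine (chebyshevMap_cos_nat_mul_pi_div hd0 2).trans ?_
        simp

theorem inducesPartialSelfCovering_chebyshev {d : ℕ} (hd : 2 ≤ d) :
    InducesPartialSelfCovering (chebyshevMap d) {-1, 1} d where
  mapsTo := chebyshevMap_mapsTo d
  pathConnected := by
    refine isPathConnected_iff_pathConnectedSpace.mp
      (Set.Countable.isPathConnected_compl_of_one_lt_rank ?_ (Set.toFinite _).countable)
    rw [Complex.rank_real_complex]
    exact Cardinal.one_lt_two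
  locPathConnected := (Set.toFinite _).isClosed.isOpen_compl.locallyPathConnectedSpace
  two_le := hd
  isCovering := isCoveringMap_iterCover_chebyshev d 1
  degree := card_fibre_restrictPreimage (by omega) rfl

end PostCritical

end

theorem mainTheorem9 (d : ℕ) (hd : 2 ≤ d) :
    -- the post-critical set, and the induced partial self-covering of degree `d`
    postCriticalSet (Polynomial.Chebyshev.T ℂ d) = {-1, 1} ∧
    InducesPartialSelfCovering (chebyshevMap d) {-1, 1} d ∧
    -- `[a]` and `[b]` generate the fundamental group
    Subgroup.closure {loopClass loopA, loopClass loopB} = ⊤ ∧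
    -- the kernel of the monodromy action
    (chebyshevMonodromy d).ker =
      Subgroup.normalClosure {loopClass (loopA.trans loopA), loopClass (loopB.trans loopB)} ∧
    -- the iterated monodromy group is `⟨a, b | a², b²⟩`
    (∃ e : PresentedGroup dihedralRels ≃* ChebyshevIMG d,
      e (PresentedGroup.of 0) = toChebyshevIMG d (loopClass loopA) ∧
      e (PresentedGroup.of 1) = toChebyshevIMG d (loopClass loopB)) ∧
    -- it is the isometry group of `ℤ`
    (∃ e : ChebyshevIMG d ≃* (ℤ ≃ᵢ ℤ),
      (∀ k : ℤ, e (toChebyshevIMG d (loopClass loopA)) k = -k) ∧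
      (∀ k : ℤ, e (toChebyshevIMG d (loopClass loopB)) k = 1 - k)) ∧
    -- `[a.b]` and `[b.a]` act as cyclic permutations of order `d ^ n` on level `n`
    (∀ n : ℕ,
      Nat.card (PreimageLevel (chebyshevMap d) {-1, 1} basePt n) = d ^ n ∧
      (chebyshevLevel d n (loopClass (loopA.trans loopB))).IsCycleOn Set.univ ∧
      orderOf (chebyshevLevel d n (loopClass (loopA.trans loopB))) = d ^ n ∧
      (chebyshevLevel d n (loopClass (loopB.trans loopA))).IsCycleOn Set.univ ∧
      orderOf (chebyshevLevel d n (loopClass (loopB.trans loopA))) = d ^ n) := by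
  have hd0 : 0 < d := by omega
  refine ⟨postCriticalSet_chebyshev hd, inducesPartialSelfCovering_chebyshev hd,
    closure_loopClass_eq_top, ?_, exists_presentedGroup_equiv_chebyshevIMG hd,
    exists_chebyshevIMG_equiv_int_isometry hd, fun n => ?_⟩
  · exact ker_eq_normalClosure_of_involutions closure_loopClass_eq_top (chebyshevMonodromy d)
      (chebyshevMonodromy_loopA_sq hd0) (chebyshevMonodromy_loopB_sq hd0)
      fun _ => chebyshevMonodromy_mul_zpow_eq_one hd
  · have hab := chebyshevLevel_loopA_trans_loopB hd0 n
    have hba := chebyshevLevel_loopB_trans_loopA hd0 n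
    have hx := levelPoint_surjective hd0 n
    have hx' := levelPoint_neg_surjective hd0 n
    exact ⟨card_fibre_restrictPreimage (pow_pos hd0 n) (chebyshevMap_iterate d n) basePt,
      isCycleOn_univ_of_apply_add_one hab hx,
      orderOf_eq_of_apply_add_one hab hx (levelPoint_eq_iff hd0 n),
      isCycleOn_univ_of_apply_add_one hba hx',
      orderOf_eq_of_apply_add_one hba hx' (levelPoint_neg_eq_iff hd0 n)⟩
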